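/- Let $Z$ be the ring of entire functions, that is, of holomorphic functions $\mathbb{C}\to\mathbb{C}$ with pointwise addition and multiplication. Then $Z$ is a Bézout domain: it is an integral domain in which every finitely generated ideal is principal. Denote by $Q$ the fraction field of $Z$, and call a finite family of elements of a commutative ring *coprime* if every common divisor of all of its members is a unit. The ring $Z$ satisfies the coprime Schinzel Hypothesis $\mathcal{C}opSch(1,1)$: let $\ell\ge 2$ and let $P_1(t),\ldots,P_\ell(t)\in Z[t]$ be nonzero polynomials that are coprime in $Q[t]$ and such that no non-unit of $Z$ divides all the values $P_1(z),\ldots,P_\ell(z)$ with $z\in Z$; then there exists $m\in Z$ such that $P_1(m),\ldots,P_\ell(m)$ are coprime in $Z$. Moreover, $Z$ is not Noetherian, and $Z$ is not a near UFD, where an integral domain is called a *near UFD* if every nonzero element has, up to multiplication by units, only finitely many prime divisors, and every nonzero non-unit has at least one prime divisor. -/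

import Mathlib

open Polynomial

/-- The ring of entire functions: the functions `ℂ → ℂ` that are complex differentiable everywhere,
with pointwise addition and multiplication. -/
def EntireFunctions : Subring (ℂ → ℂ) where
  carrier := {f | Differentiable ℂ f}
  mul_mem' hf hg := Differentiable.mul hf hg
  one_mem' := differentiable_const 1
  add_mem' hf hg := Differentiable.add hf hg
  zero_mem' := differentiable_const 0
  neg_mem' hf := Differentiable.neg hf

/-- Elements `a i` of a commutative ring are coprime (as a family, not pairwise) if every
common divisor of all of them is a unit. -/
def CoprimeFamily {R : Type*} [CommRing R] {ι : Type*} (a : ι → R) : Prop :=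
  ∀ d : R, (∀ i, d ∣ a i) → IsUnit d

/-- The coprime Schinzel Hypothesis for one finite family of polynomials in one variable, over a
ring `Z` (meant for integral domains) with fraction field `Q`: nonzero `P₁, …, P_ℓ ∈ Z[t]`, `ℓ ≥ 2`,
that are coprime in `Q[t]` and such that no non-unit of `Z` divides all their values on `Z` take
coprime values at some `m ∈ Z`. -/
def CopSchOneOne (Z : Type*) [CommRing Z] : Prop :=
  ∀ (ℓ : ℕ) (P : Fin ℓ → Z[X]), 2 ≤ ℓ → (∀ i, P i ≠ 0) →
    CoprimeFamily (fun i => (P i).map (algebraMap Z (FractionRing Z))) →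
    (∀ a : Z, ¬ IsUnit a → ¬ ∀ (i : Fin ℓ) (z : Z), a ∣ (P i).eval z) →
    ∃ m : Z, CoprimeFamily (fun i => (P i).eval m)

/-- Near UFDs: integral domains in which every nonzero element has only finitely many prime divisors
(up to units) and every nonzero non-unit has at least one prime divisor. -/
structure IsNearUFD (Z : Type*) [CommRing Z] : Prop where
  isDomain : IsDomain Z
  finite_primeDivisors : ∀ a : Z, a ≠ 0 →
    {q : Associates Z | ∃ p : Z, Prime p ∧ p ∣ a ∧ Associates.mk p = q}.Finite
  exists_primeDivisor : ∀ a : Z, a ≠ 0 → ¬ IsUnit a → ∃ p : Z, Prime p ∧ p ∣ a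

/-! Problems are solved on discs and glued over ℂ. Gluing is an additive Cousin problem: Taylor
polynomials approximate the transition functions, so that the corrected sums converge
(`exists_differentiableOn_ball_cobounding`). On a disc, a gcd with a Bézout relation exists because
`f ≠ 0` has finitely many zeros there; local gcds differ by nonvanishing factors, hence by
exponentials, and patch to a global gcd (`exists_eq_mul_isCoprime`). The same method gives
interpolation on the zeros of any `δ ≠ 0` (`exists_interpolating`).

For the Schinzel property, the ideal of the `P i` contains a constant `δ ≠ 0`, so the values at `m`
can vanish together only at zeros of `δ`; prescribing `m` there prevents it. The zeros of `sin (π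
z)` give infinitely many primes, which refutes the near UFD property and with it Noetherianity. -/

/-! ### Approximation and gluing on discs -/

open Metric Set in
/-- A holomorphic function on a disc is uniformly approximated by entire functions on smaller
discs. -/
theorem DifferentiableOn.exists_entire_approx {L : ℂ → ℂ} {r R : ℝ} (hr : 0 ≤ r) (hrR : r < R)
    (hL : DifferentiableOn ℂ L (ball 0 R)) {ε : ℝ} (hε : 0 < ε) :
    ∃ h : ℂ → ℂ, Differentiable ℂ h ∧ ∀ z ∈ ball (0 : ℂ) r, ‖L z - h z‖ ≤ ε := by
  obtain ⟨s, hrs, hsR⟩ := exists_between hrR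
  lift r to NNReal using hr
  lift s to NNReal using r.2.trans hrs.le
  have hps := (hL.mono (closedBall_subset_ball hsR)).hasFPowerSeriesOnBall
    (lt_of_le_of_lt r.2 hrs)
  have hu := hps.tendstoUniformlyOn (r' := r) (by exact_mod_cast hrs)
  obtain ⟨n, hn⟩ := ((Metric.tendstoUniformlyOn_iff.1 hu) ε hε).exists
  refine ⟨fun z => (cauchyPowerSeries L 0 s).partialSum n z, ?_, fun z hz => ?_⟩
  · simp only [FormalMultilinearSeries.partialSum,
      FormalMultilinearSeries.apply_eq_pow_smul_coeff]
    fun_prop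
  · have := hn z hz
    rw [dist_eq_norm, zero_add] at this
    exact this.le

open Metric Set in
/-- Functions on the discs of integral radius that agree with each other come from an entire
function. -/
theorem exists_entire_of_eqOn_ball {F : ℕ → ℂ → ℂ}
    (hF : ∀ n, DifferentiableOn ℂ (F n) (ball 0 n))
    (hFF : ∀ n, EqOn (F n) (F (n + 1)) (ball 0 n)) :
    ∃ G : ℂ → ℂ, Differentiable ℂ G ∧ ∀ n, EqOn G (F n) (ball 0 n) := by
  have hsub : ∀ {m n : ℕ}, m ≤ n → ball (0 : ℂ) m ⊆ ball 0 n := fun h =>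
    ball_subset_ball (by exact_mod_cast h)
  have hmn : ∀ m n, m ≤ n → EqOn (F m) (F n) (ball 0 m) := by
    intro m n h
    induction n, h using Nat.le_induction with
    | base => exact fun _ _ => rfl
    | succ k hk ih => exact fun z hz => (ih hz).trans (hFF k (hsub hk hz))
  have hG : ∀ n, EqOn (fun z => F (⌊‖z‖⌋₊ + 1) z) (F n) (ball 0 n) := by
    intro n z hz
    have hz' : z ∈ ball (0 : ℂ) ((⌊‖z‖⌋₊ + 1 : ℕ) : ℝ) := by
      rw [mem_ball_zero_iff]; push_cast; exact Nat.lt_floor_add_one _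
    rcases le_total n (⌊‖z‖⌋₊ + 1) with h | h
    · exact (hmn _ _ h hz).symm
    · exact hmn _ _ h hz'
  refine ⟨_, fun z => ?_, hG⟩
  obtain ⟨n, hn⟩ := exists_nat_gt ‖z‖
  have hz : ball (0 : ℂ) n ∈ nhds z := isOpen_ball.mem_nhds (by simpa using hn)
  exact ((hF n).congr (hG n)).differentiableAt hz

open Metric Set in
/-- The additive Cousin problem for the exhaustion of the plane by discs of integral radius. -/
theorem exists_differentiableOn_ball_cobounding {L : ℕ → ℂ → ℂ}
    (hL : ∀ n : ℕ, DifferentiableOn ℂ (L n) (ball 0 (n + 1))) :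
    ∃ T : ℕ → ℂ → ℂ, (∀ n : ℕ, DifferentiableOn ℂ (T n) (ball 0 n)) ∧
      ∀ n : ℕ, ∀ z ∈ ball (0 : ℂ) n, T n z = T (n + 1) z + L n z := by
  choose h hd hh using fun n : ℕ => (hL n).exists_entire_approx n.cast_nonneg
    (lt_add_one (n : ℝ)) (pow_pos (one_half_pos (α := ℝ)) n)
  have hsum : ∀ n : ℕ, Summable fun k => (1 / 2 : ℝ) ^ (n + k) := fun n => by
    simpa [pow_add] using summable_geometric_two.mul_left ((1 / 2 : ℝ) ^ n)
  have hsub : ∀ n k : ℕ, ball (0 : ℂ) n ⊆ ball 0 ((n + k : ℕ) : ℝ) := fun n k =>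
    ball_subset_ball (by push_cast; linarith [k.cast_nonneg (α := ℝ)])
  have hbd : ∀ n k : ℕ, ∀ z ∈ ball (0 : ℂ) n,
      ‖L (n + k) z - h (n + k) z‖ ≤ (1 / 2 : ℝ) ^ (n + k) := fun n k z hz =>
    hh _ z (hsub n k hz)
  -- Passing from `n` to `n + 1` drops `L n - h n` from the tail and subtracts a further `h n`, a
  -- total change of `-L n`.
  refine ⟨fun n z => (∑' k, (L (n + k) z - h (n + k) z)) - ∑ j ∈ Finset.range n, h j z,
    fun n => ?_, fun n z hz => ?_⟩
  · refine DifferentiableOn.sub ?_ ?_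
    · refine Complex.differentiableOn_tsum_of_summable_norm (hsum n) (fun k => ?_) isOpen_ball
        (hbd n)
      refine ((hL _).mono ?_).sub (hd _).differentiableOn
      exact (hsub n k).trans (ball_subset_ball (by linarith))
    · exact (Differentiable.fun_sum fun j _ => hd j).differentiableOn
  · have hs : Summable fun k => L (n + k) z - h (n + k) z :=
      Summable.of_norm_bounded (hsum n) fun k => hbd n k z hz
    have e : ∀ k, L (n + (k + 1)) z - h (n + (k + 1)) z
        = L (n + 1 + k) z - h (n + 1 + k) z := fun k => by rw [add_right_comm, add_assoc]
    simp only [hs.tsum_eq_zero_add, e, Finset.sum_range_succ, add_zero]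
    ring

open Metric Set in
/-- Nowhere vanishing holomorphic functions on a disc have a holomorphic logarithm. -/
theorem DifferentiableOn.exists_exp_eq {f : ℂ → ℂ} {R : ℝ} (hR : 0 < R)
    (hf : DifferentiableOn ℂ f (ball 0 R)) (hf0 : ∀ z ∈ ball (0 : ℂ) R, f z ≠ 0) :
    ∃ L : ℂ → ℂ, DifferentiableOn ℂ L (ball 0 R) ∧
      ∀ z ∈ ball (0 : ℂ) R, f z = Complex.exp (L z) := by
  have h0 : (0 : ℂ) ∈ ball (0 : ℂ) R := mem_ball_self hR
  obtain ⟨L, hL0, hL⟩ := ((hf.deriv isOpen_ball).div hf hf0).isExactOn_ball.with_val_at 0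
    (Complex.log (f 0))
  have hLd : DifferentiableOn ℂ L (ball 0 R) := fun z hz =>
    (hL z hz).differentiableAt.differentiableWithinAt
  refine ⟨L, hLd, fun z hz => ?_⟩
  have hd : ∀ w ∈ ball (0 : ℂ) R,
      HasDerivAt (fun w => f w * Complex.exp (-L w)) 0 w := fun w hw => by
    have h1 := (hf.differentiableAt (isOpen_ball.mem_nhds hw)).hasDerivAt
    refine (h1.mul (hL w hw).neg.cexp).congr_deriv ?_
    have := hf0 w hw
    simp only [Pi.div_apply, Pi.neg_apply]
    field_simp
    ring
  have hc := (convex_ball (0 : ℂ) R).is_const_of_fderivWithin_eq_zero (𝕜 := ℂ)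
    (f := fun w => f w * Complex.exp (-L w))
    (fun w hw => (hd w hw).differentiableAt.differentiableWithinAt)
    (fun w hw => by
      rw [fderivWithin_of_isOpen isOpen_ball hw]
      ext; simp [(hd w hw).deriv]) hz h0
  simp only [hL0, Complex.exp_neg, Complex.exp_log (hf0 0 h0), mul_inv_cancel₀ (hf0 0 h0)] at hc
  exact (mul_inv_eq_one₀ (Complex.exp_ne_zero _)).1 hc

/-! ### Zeros and linear factors of entire functions -/

namespace EntireFunctions

open Metric Set

/-- Evaluation of entire functions at a point. -/
def evalAt (w : ℂ) : EntireFunctions →+* ℂ :=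
  (Pi.evalRingHom (fun _ : ℂ => ℂ) w).comp EntireFunctions.subtype

theorem evalAt_apply (w : ℂ) (f : EntireFunctions) : evalAt w f = f.1 w := rfl

theorem differentiable (f : EntireFunctions) : Differentiable ℂ f.1 := f.2

theorem analyticOnNhd (f : EntireFunctions) (s : Set ℂ) : AnalyticOnNhd ℂ f.1 s :=
  fun z _ => (differentiable f).analyticAt z

theorem ext_evalAt {f g : EntireFunctions} (h : ∀ z, evalAt z f = evalAt z g) : f = g :=
  Subtype.ext (funext h)

theorem eq_zero_of_frequently {f : EntireFunctions} {w : ℂ}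
    (h : ∃ᶠ z in nhdsWithin w {w}ᶜ, f.1 z = 0) : f = 0 :=
  Subtype.ext <| funext fun z =>
    ((analyticOnNhd f) univ).eqOn_zero_of_preconnected_of_frequently_eq_zero isPreconnected_univ
      (mem_univ w) h (mem_univ z)

theorem finite_zeros {f : EntireFunctions} (hf : f ≠ 0) (R : ℝ) :
    {z ∈ ball (0 : ℂ) R | f.1 z = 0}.Finite := by
  by_contra h
  obtain ⟨w, -, hw⟩ := Set.Infinite.exists_accPt_of_subset_isCompact h
    (isCompact_closedBall (0 : ℂ) R) (fun z hz => ball_subset_closedBall hz.1)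
  exact hf (eq_zero_of_frequently ((accPt_iff_frequently_nhdsNE.1 hw).mono fun z hz => hz.2))

/-- Zeros of `p` are isolated: cancel away from them, then use continuity. -/
theorem eqOn_of_mul_eqOn {p : EntireFunctions} (hp : p ≠ 0) {R : ℝ} {h k : ℂ → ℂ}
    (hh : DifferentiableOn ℂ h (ball 0 R)) (hk : DifferentiableOn ℂ k (ball 0 R))
    (H : ∀ z ∈ ball (0 : ℂ) R, p.1 z * h z = p.1 z * k z) : EqOn h k (ball 0 R) := by
  intro w hw
  have hne : ∀ᶠ z in nhdsWithin w {w}ᶜ, p.1 z ≠ 0 := by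
    by_contra hc
    exact hp (eq_zero_of_frequently (Filter.not_eventually.1 hc |>.mono fun z hz => not_not.1 hz))
  have hnb := isOpen_ball.mem_nhds hw
  have hev : h =ᶠ[nhdsWithin w {w}ᶜ] k := by
    filter_upwards [hne, nhdsWithin_le_nhds hnb] with z h1 h2
    exact mul_left_cancel₀ h1 (H z h2)
  exact tendsto_nhds_unique
    ((hh.differentiableAt hnb).continuousAt.mono_left nhdsWithin_le_nhds |>.congr' hev)
    ((hk.differentiableAt hnb).continuousAt.mono_left nhdsWithin_le_nhds)

instance : IsDomain EntireFunctions := by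
  have : NoZeroDivisors EntireFunctions := ⟨fun {f g} h => by
    by_contra! hc
    have := eqOn_of_mul_eqOn hc.1 (R := 0 + 1) (h := g.1) (k := 0)
      (differentiable g).differentiableOn (differentiableOn_const 0)
      (fun z _ => by
        rw [Pi.zero_apply, mul_zero]; exact congrArg (evalAt z) h)
    refine hc.2 (eq_zero_of_frequently (w := 0) (Filter.Eventually.frequently ?_))
    filter_upwards [nhdsWithin_le_nhds (ball_mem_nhds (0 : ℂ) (zero_lt_one.trans_eq
      (zero_add (1 : ℝ)).symm))] with z hz using this hz⟩
  exact NoZeroDivisors.to_isDomain _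

theorem isUnit_of_forall_ne_zero {f : EntireFunctions} (h : ∀ z, f.1 z ≠ 0) : IsUnit f :=
  IsUnit.of_mul_eq_one ⟨fun z => (f.1 z)⁻¹, (differentiable f).inv h⟩
    (ext_evalAt fun z => by simpa [evalAt_apply] using mul_inv_cancel₀ (h z))

/-- The entire function `z ↦ z - w`. -/
def linear (w : ℂ) : EntireFunctions := ⟨fun z => z - w, differentiable_id.sub_const w⟩

@[simp] theorem evalAt_linear (z w : ℂ) : evalAt z (linear w) = z - w := rfl

/-- The divided difference of an entire function at a point. -/
noncomputable def divDiff (w : ℂ) (f : EntireFunctions) : EntireFunctions :=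
  ⟨dslope f.1 w, differentiableOn_univ.1
    ((Complex.differentiableOn_dslope Filter.univ_mem).2 (differentiable f).differentiableOn)⟩

theorem linear_mul_divDiff (w : ℂ) (f : EntireFunctions) {c : EntireFunctions}
    (hc : ∀ z, evalAt z c = f.1 w) : linear w * divDiff w f = f - c :=
  ext_evalAt fun z => by
    rw [map_sub, hc]
    exact sub_smul_dslope f.1 w z

theorem linear_dvd_iff {w : ℂ} {f : EntireFunctions} : linear w ∣ f ↔ f.1 w = 0 := by
  constructor
  · rintro ⟨g, rfl⟩
    change (w - w) * g.1 w = 0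
    rw [sub_self, zero_mul]
  · intro h
    exact ⟨divDiff w f, by rw [linear_mul_divDiff w f (c := 0) (by simp [h]), sub_zero]⟩

theorem linear_ne_zero (w : ℂ) : linear w ≠ 0 := fun h => by
  simpa using congrArg (evalAt (w + 1)) h

theorem not_isUnit_linear (w : ℂ) : ¬ IsUnit (linear w) := fun h => by
  simpa using h.map (evalAt w)

theorem prime_linear (w : ℂ) : Prime (linear w) := by
  refine ⟨linear_ne_zero w, not_isUnit_linear w, fun a b h => ?_⟩
  rw [linear_dvd_iff] at h ⊢
  rw [linear_dvd_iff]
  exact mul_eq_zero.1 h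

theorem isCoprime_linear {w : ℂ} {g : EntireFunctions} (h : g.1 w ≠ 0) :
    IsCoprime (linear w) g := by
  let c : ℂ → EntireFunctions := fun a => ⟨fun _ => a, differentiable_const a⟩
  refine ⟨-(c (g.1 w)⁻¹ * divDiff w g), c (g.1 w)⁻¹, ?_⟩
  have h1 := linear_mul_divDiff w g (c := c (g.1 w)) fun _ => rfl
  have h2 : c (g.1 w)⁻¹ * c (g.1 w) = 1 := ext_evalAt fun z => by
    simpa [c, evalAt_apply] using inv_mul_cancel₀ h
  linear_combination -(c (g.1 w)⁻¹) * h1 + h2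

theorem exists_eq_linear_pow_mul {f : EntireFunctions} (hf : f ≠ 0) (w : ℂ) :
    ∃ (k : ℕ) (g : EntireFunctions), f = linear w ^ k * g ∧ g.1 w ≠ 0 := by
  obtain ⟨p, hp⟩ := (differentiable f).analyticAt w
  have hp0 : p ≠ 0 := fun h => hf (eq_zero_of_frequently (w := w)
    ((hp.locally_zero_iff.2 h).filter_mono nhdsWithin_le_nhds).frequently)
  have hit : ∀ n : ℕ, ((divDiff w)^[n] f).1 = (Function.swap dslope w)^[n] f.1 := fun n => by
    induction n with
    | zero => rfl
    | succ n ih => rw [Function.iterate_succ_apply', Function.iterate_succ_apply', ← ih]; rfl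
  refine ⟨p.order, (divDiff w)^[p.order] f, ext_evalAt fun z => ?_, ?_⟩
  · rw [map_mul, map_pow, evalAt_linear, evalAt_apply, evalAt_apply, hit]
    exact hp.eq_pow_order_mul_iterate_dslope z
  · rw [hit]
    exact hp.iterate_dslope_fslope_ne_zero hp0

/-- The zeros of a nonzero entire function in a disc split off as linear factors. -/
theorem exists_eq_prod_linear_mul {f : EntireFunctions} (hf : f ≠ 0) (R : ℝ) :
    ∃ (s : Multiset ℂ) (g : EntireFunctions), f = (s.map linear).prod * g ∧
      (∀ w ∈ s, w ∈ ball (0 : ℂ) R) ∧ ∀ z ∈ ball (0 : ℂ) R, g.1 z ≠ 0 := by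
  induction hn : {z ∈ ball (0 : ℂ) R | f.1 z = 0}.ncard using Nat.strong_induction_on
    generalizing f with
  | _ n ih =>
  by_cases hz : ∃ w ∈ ball (0 : ℂ) R, f.1 w = 0
  · obtain ⟨w, hwR, hw⟩ := hz
    obtain ⟨k, g, rfl, hg⟩ := exists_eq_linear_pow_mul hf w
    have hlt : {z ∈ ball (0 : ℂ) R | g.1 z = 0}.ncard < n := by
      rw [← hn]
      refine Set.ncard_lt_ncard ⟨fun z hz => ⟨hz.1, ?_⟩, fun h => hg (h ⟨hwR, hw⟩).2⟩
        (finite_zeros hf R)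
      change (linear w ^ k).1 z * g.1 z = 0
      rw [hz.2, mul_zero]
    obtain ⟨s, h, rfl, hs, hh⟩ := ih _ hlt (right_ne_zero_of_mul hf) rfl
    refine ⟨Multiset.replicate k w + s, h, ?_, fun z hz => ?_, hh⟩
    · simp [mul_assoc]
    · rcases Multiset.mem_add.1 hz with hz | hz
      · rwa [Multiset.eq_of_mem_replicate hz]
      · exact hs z hz
  · push Not at hz
    exact ⟨0, f, by simp, by simp, hz⟩

/-! ### Greatest common divisors, from discs to the plane -/

/-- On a disc, two entire functions have a greatest common divisor that is a combination of
them. -/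
theorem exists_local_gcd {f : EntireFunctions} (hf : f ≠ 0) (g : EntireFunctions) (R : ℝ) :
    ∃ d f' g' : EntireFunctions, f = d * f' ∧ g = d * g' ∧ ∃ α β : ℂ → ℂ,
      DifferentiableOn ℂ α (ball 0 R) ∧ DifferentiableOn ℂ β (ball 0 R) ∧
      ∀ z ∈ ball (0 : ℂ) R, α z * f'.1 z + β z * g'.1 z = 1 := by
  obtain ⟨s, f, rfl, -, hf0⟩ := exists_eq_prod_linear_mul hf R
  clear hf
  induction s using Multiset.induction_on with
  | empty =>
    refine ⟨1, f, g, by simp, by simp, fun z => (f.1 z)⁻¹, 0,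
      (differentiable f).differentiableOn.inv hf0, differentiableOn_const 0, fun z hz => ?_⟩
    simp [inv_mul_cancel₀ (hf0 z hz)]
  | cons w s ih =>
    obtain ⟨d, f', g', h1, h2, α, β, hα, hβ, h⟩ := ih
    rw [Multiset.map_cons, Multiset.prod_cons, mul_assoc, h1]
    -- A new factor `linear w` of `f` joins the gcd if it divides `g'`; otherwise it is coprime to
    -- `g'` and the two Bézout relations multiply.
    by_cases hw : g'.1 w = 0
    · obtain ⟨k, rfl⟩ := linear_dvd_iff.2 hw
      refine ⟨d * linear w, f', k, by ring, by rw [h2]; ring, α, fun z => β z * (linear w).1 z,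
        hα, hβ.mul (differentiable (linear w)).differentiableOn, fun z hz => ?_⟩
      rw [← h z hz, mul_assoc]; rfl
    · obtain ⟨x, y, hxy⟩ := isCoprime_linear hw
      refine ⟨d, linear w * f', g', by ring, h2, fun z => α z * x.1 z,
        fun z => α z * f'.1 z * y.1 z + β z, hα.mul (differentiable x).differentiableOn,
        ((hα.mul (differentiable f').differentiableOn).mul
          (differentiable y).differentiableOn).add hβ, fun z hz => ?_⟩
      have e : x.1 z * (linear w).1 z + y.1 z * g'.1 z = 1 := by
        simpa [evalAt_apply] using congrArg (evalAt z) hxy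
      have e' : (linear w * f').1 z = (linear w).1 z * f'.1 z := rfl
      rw [e']
      linear_combination h z hz + α z * f'.1 z * e

/-- Two Bézout relations on a disc differ by a holomorphic multiple of `(g, -f)`; these multiples
form the Cousin data `L`. -/
theorem isCoprime_of_forall_ball {f g : EntireFunctions}
    (h : ∀ n : ℕ, ∃ α β : ℂ → ℂ,
      DifferentiableOn ℂ α (ball 0 n) ∧ DifferentiableOn ℂ β (ball 0 n) ∧
      ∀ z ∈ ball (0 : ℂ) n, α z * f.1 z + β z * g.1 z = 1) : IsCoprime f g := by
  choose α β hα hβ h using h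
  have hsub : ∀ {m n : ℕ}, m ≤ n → ball (0 : ℂ) m ⊆ ball 0 n := fun h =>
    ball_subset_ball (by exact_mod_cast h)
  obtain ⟨T, hT, hTL⟩ := exists_differentiableOn_ball_cobounding
    (L := fun n z => α (n + 2) z * β (n + 1) z - α (n + 1) z * β (n + 2) z) (fun n => by
      have e : ball (0 : ℂ) ((n : ℝ) + 1) = ball 0 ((n + 1 : ℕ) : ℝ) := by push_cast; rfl
      rw [e]
      have h1 := hsub (Nat.le_succ (n + 1))
      exact (((hα (n + 2)).mono h1).mul (hβ (n + 1))).sub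
        ((hα (n + 1)).mul ((hβ (n + 2)).mono h1)))
  have h1 : ∀ n : ℕ, ∀ z ∈ ball (0 : ℂ) n, α (n + 1) z * f.1 z + β (n + 1) z * g.1 z = 1 :=
    fun n z hz => h _ z (hsub (Nat.le_add_right n 1) hz)
  have h2 : ∀ n : ℕ, ∀ z ∈ ball (0 : ℂ) n, α (n + 2) z * f.1 z + β (n + 2) z * g.1 z = 1 :=
    fun n z hz => h _ z (hsub (Nat.le_add_right n 2) hz)
  obtain ⟨a, ha, haF⟩ := exists_entire_of_eqOn_ball (F := fun n z => α (n + 1) z + T n z * g.1 z)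
    (fun n => ((hα (n + 1)).mono (hsub (Nat.le_succ n))).add
      ((hT n).mul (differentiable g).differentiableOn))
    (fun n z hz => by
      simp only [hTL n z hz]
      linear_combination α (n + 2) z * h1 n z hz - α (n + 1) z * h2 n z hz)
  obtain ⟨b, hb, hbF⟩ := exists_entire_of_eqOn_ball (F := fun n z => β (n + 1) z - T n z * f.1 z)
    (fun n => ((hβ (n + 1)).mono (hsub (Nat.le_succ n))).sub
      ((hT n).mul (differentiable f).differentiableOn))
    (fun n z hz => by
      simp only [hTL n z hz]
      linear_combination β (n + 2) z * h1 n z hz - β (n + 1) z * h2 n z hz)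
  refine ⟨⟨a, ha⟩, ⟨b, hb⟩, ext_evalAt fun z => ?_⟩
  obtain ⟨n, hn⟩ := exists_nat_gt ‖z‖
  have hz : z ∈ ball (0 : ℂ) n := by simpa using hn
  simp only [map_add, map_mul, map_one, evalAt_apply, haF n hz, hbF n hz]
  linear_combination h1 n z hz

/-- Two entire functions have a greatest common divisor with coprime cofactors. -/
theorem exists_eq_mul_isCoprime {f : EntireFunctions} (hf : f ≠ 0) (g : EntireFunctions) :
    ∃ d f' g' : EntireFunctions, f = d * f' ∧ g = d * g' ∧ IsCoprime f' g' := by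
  choose p f' g' hfp hgp α β hα hβ h using fun n : ℕ => exists_local_gcd hf g ((n : ℝ) + 1)
  have hp : ∀ n, p n ≠ 0 := fun n hn => hf (by rw [hfp n, hn, zero_mul])
  have hsub : ∀ n : ℕ, ball (0 : ℂ) ((n : ℝ) + 1) ⊆ ball 0 (((n + 1 : ℕ) : ℝ) + 1) := fun n =>
    ball_subset_ball (by push_cast; linarith)
  have hsub' : ∀ n : ℕ, ball (0 : ℂ) n ⊆ ball 0 ((n : ℝ) + 1) := fun n =>
    ball_subset_ball (by linarith)
  have hfz : ∀ n z, f.1 z = (p n).1 z * (f' n).1 z := fun n z => congrArg (evalAt z) (hfp n)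
  have hgz : ∀ n z, g.1 z = (p n).1 z * (g' n).1 z := fun n z => congrArg (evalAt z) (hgp n)
  -- By the Bézout relations, consecutive local gcds divide each other on the smaller disc, with
  -- quotients `u` and `v`.
  let u : ℕ → ℂ → ℂ := fun n z => α (n + 1) z * (f' n).1 z + β (n + 1) z * (g' n).1 z
  let v : ℕ → ℂ → ℂ := fun n z => α n z * (f' (n + 1)).1 z + β n z * (g' (n + 1)).1 z
  have hud : ∀ n : ℕ, DifferentiableOn ℂ (u n) (ball 0 ((n : ℝ) + 1)) := fun n =>
    (((hα (n + 1)).mono (hsub n)).mul (differentiable (f' n)).differentiableOn).add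
      (((hβ (n + 1)).mono (hsub n)).mul (differentiable (g' n)).differentiableOn)
  have hvd : ∀ n : ℕ, DifferentiableOn ℂ (v n) (ball 0 ((n : ℝ) + 1)) := fun n =>
    ((hα n).mul (differentiable (f' (n + 1))).differentiableOn).add
      ((hβ n).mul (differentiable (g' (n + 1))).differentiableOn)
  have hpu : ∀ n : ℕ, ∀ z ∈ ball (0 : ℂ) ((n : ℝ) + 1),
      (p (n + 1)).1 z = (p n).1 z * u n z := fun n z hz => by
    simp only [u]
    linear_combination -(p (n + 1)).1 z * h (n + 1) z (hsub n hz)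
      - α (n + 1) z * hfz (n + 1) z + α (n + 1) z * hfz n z
      - β (n + 1) z * hgz (n + 1) z + β (n + 1) z * hgz n z
  have hpv : ∀ n : ℕ, ∀ z ∈ ball (0 : ℂ) ((n : ℝ) + 1),
      (p n).1 z = (p (n + 1)).1 z * v n z := fun n z hz => by
    simp only [v]
    linear_combination -(p n).1 z * h n z hz
      + α n z * hfz (n + 1) z - α n z * hfz n z
      + β n z * hgz (n + 1) z - β n z * hgz n z
  have huv : ∀ n : ℕ, EqOn (fun z => u n z * v n z) 1 (ball 0 ((n : ℝ) + 1)) := fun n =>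
    eqOn_of_mul_eqOn (hp n) ((hud n).mul (hvd n)) (differentiableOn_const 1) fun z hz => by
      rw [← mul_assoc, ← hpu n z hz, ← hpv n z hz]; exact (mul_one _).symm
  choose L hL huL using fun n : ℕ => (hud n).exists_exp_eq n.cast_add_one_pos
    (fun z hz => left_ne_zero_of_mul_eq_one (huv n hz))
  obtain ⟨T, hT, hTL⟩ := exists_differentiableOn_ball_cobounding hL
  have hpexp : ∀ n : ℕ, ∀ z ∈ ball (0 : ℂ) n,
      (p (n + 1)).1 z = (p n).1 z * Complex.exp (L n z) := fun n z hz => by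
    rw [hpu n z (hsub' n hz), huL n z (hsub' n hz)]
  -- Cofactors change by the inverse factor, so twisting them by `exp (-T n)` makes them glue, as
  -- `exp (T n)` does for the gcds.
  have hcof : ∀ (F : ℕ → EntireFunctions) (k : EntireFunctions),
      (∀ n z, k.1 z = (p n).1 z * (F n).1 z) → ∀ n : ℕ, ∀ z ∈ ball (0 : ℂ) n,
      (F n).1 z = Complex.exp (L n z) * (F (n + 1)).1 z := fun F k hk n => by
    refine eqOn_of_mul_eqOn (hp n) (differentiable (F n)).differentiableOn
      (((hL n).mono (hsub' n)).cexp.mul (differentiable (F (n + 1))).differentiableOn)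
      fun z hz => ?_
    rw [← hk, ← mul_assoc, ← hpexp n z hz, hk (n + 1)]
  obtain ⟨d, hd, hdF⟩ := exists_entire_of_eqOn_ball
    (F := fun n z => (p n).1 z * Complex.exp (T n z))
    (fun n => (differentiable (p n)).differentiableOn.mul (hT n).cexp)
    (fun n z hz => by
      simp only [hTL n z hz, hpexp n z hz, Complex.exp_add]; ring)
  have hglue : ∀ (F : ℕ → EntireFunctions) (k : EntireFunctions),
      (∀ n z, k.1 z = (p n).1 z * (F n).1 z) → ∃ G : EntireFunctions,
        ∀ n : ℕ, ∀ z ∈ ball (0 : ℂ) n, G.1 z = (F n).1 z * Complex.exp (-T n z) :=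
      fun F k hk => by
    obtain ⟨G, hG, hGF⟩ := exists_entire_of_eqOn_ball
      (F := fun n z => (F n).1 z * Complex.exp (-T n z))
      (fun n => (differentiable (F n)).differentiableOn.mul (hT n).neg.cexp)
      (fun n z hz => by
        have := Complex.exp_ne_zero (L n z)
        simp only [hTL n z hz, hcof F k hk n z hz, neg_add, Complex.exp_add, Complex.exp_neg (L n z)]
        field_simp)
    exact ⟨⟨G, hG⟩, fun n z hz => hGF n hz⟩
  obtain ⟨A, hA⟩ := hglue f' f hfz
  obtain ⟨B, hB⟩ := hglue g' g hgz
  have hexp : ∀ w : ℂ, Complex.exp w * Complex.exp (-w) = 1 := fun w => by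
    rw [← Complex.exp_add, add_neg_cancel, Complex.exp_zero]
  have hball : ∀ z : ℂ, ∃ n : ℕ, z ∈ ball (0 : ℂ) n := fun z => by
    simpa using exists_nat_gt ‖z‖
  refine ⟨⟨d, hd⟩, A, B, ext_evalAt fun z => ?_, ext_evalAt fun z => ?_,
    isCoprime_of_forall_ball fun n => ⟨fun z => α n z * Complex.exp (T n z),
      fun z => β n z * Complex.exp (T n z), ((hα n).mono (hsub' n)).mul (hT n).cexp,
      ((hβ n).mono (hsub' n)).mul (hT n).cexp, fun z hz => ?_⟩⟩
  · obtain ⟨n, hz⟩ := hball z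
    simp only [map_mul, evalAt_apply, hdF n hz, hA n z hz]
    linear_combination hfz n z - (p n).1 z * (f' n).1 z * hexp (T n z)
  · obtain ⟨n, hz⟩ := hball z
    simp only [map_mul, evalAt_apply, hdF n hz, hB n z hz]
    linear_combination hgz n z - (p n).1 z * (g' n).1 z * hexp (T n z)
  · rw [hA n z hz, hB n z hz]
    linear_combination h n z (hsub' n hz)
      + (α n z * (f' n).1 z + β n z * (g' n).1 z) * hexp (T n z)

instance : IsBezout EntireFunctions := by
  rw [IsBezout.iff_span_pair_isPrincipal]
  intro f g
  by_cases hf : f = 0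
  · exact ⟨g, by simp [hf]⟩
  obtain ⟨d, f', g', rfl, rfl, a, b, hab⟩ := exists_eq_mul_isCoprime hf g
  refine ⟨d, le_antisymm ?_ ?_⟩
  · rw [Ideal.submodule_span_eq, Ideal.span_le]
    rintro x (rfl | rfl) <;> exact Ideal.mem_span_singleton.2 (dvd_mul_right _ _)
  · rw [Ideal.submodule_span_eq, Ideal.span_singleton_le_iff_mem, Ideal.mem_span_pair]
    exact ⟨a, b, by linear_combination d * hab⟩

end EntireFunctions

-- Coprimality over the fraction field; near UFDs

attribute [local instance] Polynomial.algebra in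
/-- Polynomials over a domain that are coprime over the fraction field generate an ideal that
contains a nonzero constant. -/
theorem CoprimeFamily.exists_C_mem_span {Z : Type*} [CommRing Z] [IsDomain Z] {ι : Type*}
    {P : ι → Z[X]}
    (h : CoprimeFamily fun i => (P i).map (algebraMap Z (FractionRing Z))) :
    ∃ a : Z, a ≠ 0 ∧ C a ∈ Ideal.span (Set.range P) := by
  have hloc := Polynomial.isLocalization (nonZeroDivisors Z) (FractionRing Z)
  have hmap : (Ideal.span (Set.range P)).map (algebraMap Z[X] (FractionRing Z)[X]) = ⊤ := by
    obtain ⟨d, hd⟩ := (IsPrincipalIdealRing.principal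
      ((Ideal.span (Set.range P)).map (algebraMap Z[X] (FractionRing Z)[X]))).principal
    rw [hd, Ideal.submodule_span_eq, Ideal.span_singleton_eq_top]
    refine h d fun i => ?_
    rw [← Ideal.mem_span_singleton, ← Ideal.submodule_span_eq, ← hd]
    exact Ideal.mem_map_of_mem _ (Ideal.subset_span ⟨i, rfl⟩)
  have h1 : algebraMap Z[X] (FractionRing Z)[X] 1 ∈
      (Ideal.span (Set.range P)).map (algebraMap Z[X] (FractionRing Z)[X]) := by
    rw [hmap]; exact Submodule.mem_top
  -- Clearing denominators in a representation of `1`.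
  obtain ⟨m, hm, hmI⟩ := (IsLocalization.algebraMap_mem_map_algebraMap_iff
    ((nonZeroDivisors Z).map C) _ _ _).1 h1
  obtain ⟨a, ha, rfl⟩ := hm
  exact ⟨a, nonZeroDivisors.ne_zero ha, by simpa using hmI⟩

/-- Unique factorization domains are near UFDs. -/
theorem UniqueFactorizationMonoid.isNearUFD (Z : Type*) [CommRing Z] [IsDomain Z]
    [UniqueFactorizationMonoid Z] : IsNearUFD Z where
  isDomain := inferInstance
  finite_primeDivisors a ha := by
    refine ((factors a).finite_toSet.image Associates.mk).subset ?_
    rintro _ ⟨p, hp, hpa, rfl⟩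
    obtain ⟨q, hq, hpq⟩ := exists_mem_factors_of_dvd ha hp.irreducible hpa
    exact ⟨q, hq, (Associates.mk_eq_mk_iff_associated.2 hpq).symm⟩
  exists_primeDivisor a ha hu := by
    obtain ⟨p, hp, hpa⟩ := WfDvdMonoid.exists_irreducible_factor hu ha
    exact ⟨p, hp.prime, hpa⟩

/-! ### Interpolation, the Schinzel property, failure of factorization -/

namespace EntireFunctions

open Metric Set

/-- The correction is divisible by the product `p` of the linear factors of `δ` in the inner disc,
hence by `δ` there, so values at inner zeros survive. -/
theorem exists_interpolating_step {δ : EntireFunctions} (hδ : δ ≠ 0) (c : ℂ → ℂ) (r R : ℝ)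
    (m : EntireFunctions) : ∃ (m' : EntireFunctions) (L : ℂ → ℂ),
      DifferentiableOn ℂ L (ball 0 r) ∧
      (∀ z ∈ ball (0 : ℂ) r, m'.1 z = m.1 z + δ.1 z * L z) ∧
      ∀ w ∈ ball (0 : ℂ) R, w ∉ ball (0 : ℂ) r → δ.1 w = 0 → m'.1 w = c w := by
  classical
  obtain ⟨s, g, hs, hsr, hg⟩ := exists_eq_prod_linear_mul hδ r
  set p := (s.map linear).prod
  have hp : ∀ w ∉ ball (0 : ℂ) r, p.1 w ≠ 0 := fun w hw => by
    rw [← evalAt_apply, map_multiset_prod]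
    refine Multiset.prod_ne_zero fun h0 => hw ?_
    simp only [Multiset.map_map, Multiset.mem_map, Function.comp_apply, evalAt_linear] at h0
    obtain ⟨v, hv, hwv⟩ := h0
    rw [sub_eq_zero.1 hwv]
    exact hsr v hv
  -- At zeros in the inner disc `p` vanishes and the quotient is the default `0`; those values play
  -- no role.
  let k : ℂ[X] := Lagrange.interpolate (finite_zeros hδ R).toFinset id
    fun w => (c w - m.1 w) / p.1 w
  refine ⟨m + p * ⟨fun z => k.eval z, k.differentiable⟩, fun z => k.eval z / g.1 z,
    k.differentiable.differentiableOn.div (differentiable g).differentiableOn hg,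
    fun z hz => ?_, fun w hwR hwr hw => ?_⟩
  · change m.1 z + p.1 z * k.eval z = _
    have : δ.1 z = p.1 z * g.1 z := congrArg (evalAt z) hs
    have := hg z hz
    rw [‹δ.1 z = _›]
    field_simp
  · change m.1 w + p.1 w * k.eval w = _
    have hk : k.eval w = (c w - m.1 w) / p.1 w :=
      Lagrange.eval_interpolate_at_node _ (Set.injOn_id _)
        ((finite_zeros hδ R).mem_toFinset.2 ⟨hwR, hw⟩)
    rw [hk, mul_div_cancel₀ _ (hp w hwr)]
    ring

/-- An entire function can be prescribed on the zeros of a nonzero entire function. -/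
theorem exists_interpolating {δ : EntireFunctions} (hδ : δ ≠ 0) (c : ℂ → ℂ) :
    ∃ m : EntireFunctions, ∀ w, δ.1 w = 0 → m.1 w = c w := by
  choose φ L hL hφ hc using exists_interpolating_step hδ c
  let M : ℕ → EntireFunctions := fun n => n.rec (φ 0 1 0) fun k m => φ (k + 1) (k + 2) m
  have hM : ∀ n, M (n + 1) = φ (n + 1) (n + 2) (M n) := fun _ => rfl
  have hMc : ∀ n : ℕ, ∀ w ∈ ball (0 : ℂ) (n + 1), δ.1 w = 0 → (M n).1 w = c w := by
    intro n
    induction n with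
    | zero =>
      intro w hw
      exact hc 0 1 0 w (by simpa using hw) (by simp)
    | succ n ih =>
      intro w hw h0
      rw [hM]
      by_cases hwn : w ∈ ball (0 : ℂ) (n + 1)
      · rw [hφ _ _ _ w hwn, h0, zero_mul, add_zero, ih w hwn h0]
      · refine hc _ _ _ w ?_ hwn h0
        convert hw using 2
        push_cast; ring
  obtain ⟨T, hT, hTL⟩ := exists_differentiableOn_ball_cobounding
    (L := fun n => L (n + 1) (n + 2) (M n)) (fun n => hL _ _ _)
  have hsub : ∀ n : ℕ, ball (0 : ℂ) n ⊆ ball 0 ((n : ℝ) + 1) := fun n =>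
    ball_subset_ball (by linarith)
  obtain ⟨m, hm, hmF⟩ := exists_entire_of_eqOn_ball (F := fun n z => (M n).1 z + δ.1 z * T n z)
    (fun n => (differentiable (M n)).differentiableOn.add
      ((differentiable δ).differentiableOn.mul (hT n)))
    (fun n z hz => by
      simp only [hTL n z hz, hM, hφ _ _ _ z (hsub n hz)]
      ring)
  refine ⟨⟨m, hm⟩, fun w hw => ?_⟩
  obtain ⟨n, hn⟩ := exists_nat_gt ‖w‖
  have hwn : w ∈ ball (0 : ℂ) n := by simpa using hn
  change m w = c w
  rw [hmF n hwn]
  beta_reduce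
  rw [hw, zero_mul, add_zero, hMc n w (hsub n hwn) hw]

theorem evalAt_eval (w : ℂ) (P : EntireFunctions[X]) (m : EntireFunctions) :
    evalAt w (P.eval m) = P.eval₂ (evalAt w) (m.1 w) :=
  (eval₂_at_apply (evalAt w) m).symm

/-- The value of `(P i).eval m` at `w` depends on `m` only through `m.1 w`. The hypothesis on
values, applied to `linear w`, supplies a good choice at each `w`. -/
theorem copSchOneOne : CopSchOneOne EntireFunctions := by
  intro ℓ P _ _ hcop hval
  obtain ⟨δ, hδ, hmem⟩ := hcop.exists_C_mem_span
  have hz : ∀ w, ∃ z : EntireFunctions, ∃ i, evalAt w ((P i).eval z) ≠ 0 := fun w => by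
    have := hval (linear w) (not_isUnit_linear w)
    push Not at this
    obtain ⟨i, z, h⟩ := this
    exact ⟨z, i, fun h0 => h (linear_dvd_iff.2 h0)⟩
  choose z i hi using hz
  obtain ⟨m, hm⟩ := exists_interpolating hδ fun w => (z w).1 w
  refine ⟨m, fun d hd => isUnit_of_forall_ne_zero fun w hw => ?_⟩
  have hPm : ∀ j, evalAt w ((P j).eval m) = 0 := fun j => by
    obtain ⟨e, he⟩ := hd j
    simp only at he
    rw [he, map_mul, evalAt_apply, hw, zero_mul]
  have hle : Ideal.span (range P) ≤ RingHom.ker ((evalAt w).comp (evalRingHom m)) := by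
    rw [Ideal.span_le]
    rintro _ ⟨j, rfl⟩
    exact hPm j
  have hδw : δ.1 w = 0 := by simpa [evalAt_apply] using hle hmem
  apply hi w
  rw [evalAt_eval, ← hm w hδw, ← evalAt_eval]
  exact hPm _

theorem not_isNearUFD : ¬ IsNearUFD EntireFunctions := by
  intro h
  let S : EntireFunctions := ⟨fun z => Complex.sin (Real.pi * z),
    show Differentiable ℂ fun z : ℂ => Complex.sin (Real.pi * z) by fun_prop⟩
  have hS : S ≠ 0 := fun h0 => by
    have : Complex.sin (Real.pi * (1 / 2)) = 0 := congrArg (evalAt (1 / 2)) h0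
    rw [mul_one_div, Complex.sin_pi_div_two] at this
    exact one_ne_zero this
  have hinj : Function.Injective fun n : ℕ => Associates.mk (linear (n : ℂ)) := fun a b hab => by
    have hd := (Associates.mk_eq_mk_iff_associated.1 hab).dvd
    have : (b : ℂ) - a = 0 := by
      have h0 : (linear (b : ℂ)).1 a = 0 := linear_dvd_iff.1 hd
      have h1 : (a : ℂ) - b = 0 := h0
      linear_combination -h1
    exact_mod_cast (sub_eq_zero.1 this).symm
  refine (Set.infinite_range_of_injective hinj) ((h.finite_primeDivisors S hS).subset ?_)
  rintro _ ⟨n, rfl⟩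
  refine ⟨linear n, prime_linear n, linear_dvd_iff.2 ?_, rfl⟩
  change Complex.sin (Real.pi * n) = 0
  rw [mul_comm]
  exact Complex.sin_nat_mul_pi n

/-- A Noetherian Bézout domain is a UFD, hence a near UFD. -/
theorem not_isNoetherianRing : ¬ IsNoetherianRing EntireFunctions := fun h => by
  have := ((IsBezout.TFAE (R := EntireFunctions)).out 0 2).1 h
  exact not_isNearUFD (UniqueFactorizationMonoid.isNearUFD _)

end EntireFunctions

theorem proposition2p5 :
    (IsDomain EntireFunctions ∧ IsBezout EntireFunctions) ∧
      CopSchOneOne EntireFunctions ∧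
      ¬ IsNoetherianRing EntireFunctions ∧
      ¬ IsNearUFD EntireFunctions :=
  ⟨⟨inferInstance, inferInstance⟩, EntireFunctions.copSchOneOne,
    EntireFunctions.not_isNoetherianRing, EntireFunctions.not_isNearUFD⟩
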